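/- Let $k$ be a field and let $A$ be a finite-dimensional $k$-algebra that is quasi-hereditary with respect to a finite poset $(\Lambda,\le)$. That is, let $L(\lambda)$ $(\lambda\in\Lambda)$ be a complete irredundant list of the simple $A$-modules up to isomorphism, let $P(\lambda)$ be the projective cover of $L(\lambda)$, and let the standard module $\Delta(\lambda)$ be the largest quotient of $P(\lambda)$ all of whose composition factors $L(\mu)$ satisfy $\mu\le\lambda$; then for every $\lambda$ all composition factors $L(\mu)$ of the kernel of $\Delta(\lambda)\to L(\lambda)$ satisfy $\mu<\lambda$, and the kernel of $P(\lambda)\to\Delta(\lambda)$ has a finite filtration whose sections are of the form $\Delta(\mu)$ with $\mu>\lambda$. Suppose that $A$ has a simple-preserving duality, i.e. a contravariant self-equivalence of the category of finite-dimensional $A$-modules which fixes every simple module up to isomorphism. Let the $\mathrm{Hom}$ quiver between standards be the quiver with vertex set labelled by the standard modules $\Delta(\lambda)$, $\lambda\in\Lambda$, and with $\dim_k\mathrm{Hom}_A(\Delta(\lambda),\Delta(\mu))$ arrows from $\lambda$ to $\mu$. Then the blocks of $A$ (given by the primitive central idempotents of $A$) may be identified with the connected components of this quiver: there is a bijection $\Phi$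 from the set of connected components (of the underlying undirected graph) onto the set of blocks of $A$ such that, for every $\lambda\in\Lambda$, the modules $L(\lambda)$, $\Delta(\lambda)$ and $P(\lambda)$ belong to the block $\Phi([\lambda])$, where $[\lambda]$ is the connected component containing $\lambda$ and a module belongs to a block if the corresponding idempotent acts on it as the identity. In particular, $L(\lambda)$ and $L(\mu)$ lie in the same block if and only if $\Delta(\lambda)$ and $\Delta(\mu)$ lie in the same connected component of the $\mathrm{Hom}$ quiver. -/

import Mathlib

open CategoryTheory

universe u v w

namespace QuasiHered

section Modules

variable (A : Type u) [Ring A]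

/-- The simple module `S` is a composition factor of `M`: it is isomorphic to a subquotient `V / U`
of `M`, where `U ≤ V` are submodules of `M`. -/
def IsCompFactor (M S : Type*) [AddCommGroup M] [Module A M] [AddCommGroup S] [Module A S] : Prop :=
  IsSimpleModule A S ∧
    ∃ U V : Submodule A M, U ≤ V ∧ Nonempty ((V ⧸ U.submoduleOf V) ≃ₗ[A] S)

/-- `P` is a projective cover of `S`: `P` is projective and there is a surjection `P → S` whose
kernel is superfluous. For simple `S` over a finite-dimensional algebra, this says that `P` is the
principal indecomposable module with head `S`. -/
def IsProjectiveCover (P S : Type*) [AddCommGroup P] [Module A P] [AddCommGroup S] [Module A S] :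
    Prop :=
  Module.Projective A P ∧ ∃ π : P →ₗ[A] S, Function.Surjective π ∧
    ∀ N : Submodule A P, N ⊔ LinearMap.ker π = ⊤ → N = ⊤

end Modules

section Weights

variable {A : Type u} [Ring A] {W : Type v}

/-- `L` is a complete and irredundant list of the simple `A`-modules up to isomorphism. -/
structure IsSimpleLabelling (L : W → ModuleCat.{u} A) : Prop where
  simple : ∀ l, IsSimpleModule A (L l)
  irredundant : ∀ l m, Nonempty (L l ≃ₗ[A] L m) → l = m
  complete : ∀ (S : Type u) [AddCommGroup S] [Module A S], IsSimpleModule A S →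
    ∃ l, Nonempty (S ≃ₗ[A] L l)

variable [PartialOrder W]

/-- The smallest submodule `U` of `P l` such that all composition factors `L m` of `P l / U`
satisfy `m ≤ l`. -/
def standardKernel (L P : W → ModuleCat.{u} A) (l : W) : Submodule A (P l) :=
  sInf {U | ∀ m, IsCompFactor A (P l ⧸ U) (L m) → m ≤ l}

/-- The standard module `Δ(l)`: the largest quotient of `P l` all of whose composition factors
`L m` satisfy `m ≤ l`. -/
abbrev standard (L P : W → ModuleCat.{u} A) (l : W) : ModuleCat.{u} A :=
  ModuleCat.of A (P l ⧸ standardKernel L P l)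

/-- `A` is quasi-hereditary with respect to the poset `W`, the simple modules `L l` and their
projective covers `P l`: the composition factors `L m` of the kernel of `Δ(l) → L l` have `m < l`,
and the kernel of `P l → Δ(l)` has a finite filtration whose sections are standard modules `Δ(m)`
with `m > l`. -/
structure IsQuasiHereditary (L P : W → ModuleCat.{u} A) : Prop where
  radical_lt : ∀ (l : W) (f : standard L P l →ₗ[A] L l), Function.Surjective f →
    ∀ m, IsCompFactor A (LinearMap.ker f) (L m) → m < l
  filtration : ∀ l : W, ∃ (n : ℕ) (F : ℕ → Submodule A (P l)),
    Monotone F ∧ F 0 = ⊥ ∧ F n = standardKernel L P l ∧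
      ∀ i < n, ∃ m, l < m ∧
        Nonempty ((F (i + 1) ⧸ (F i).submoduleOf (F (i + 1))) ≃ₗ[A] standard L P m)

end Weights

section Duality

variable (A : Type u) [Ring A]

/-- A duality on the category of finitely generated `A`-modules: a contravariant
self-equivalence. -/
abbrev Duality := (FGModuleCat.{u} A)ᵒᵖ ≌ FGModuleCat.{u} A

variable {A}

/-- The duality fixes every simple module up to isomorphism. -/
def Duality.SimplePreserving (D : Duality A) : Prop :=
  ∀ S : FGModuleCat.{u} A, IsSimpleModule A S →
    Nonempty (D.functor.obj (Opposite.op S) ≃ₗ[A] S)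

end Duality

section Blocks

/-- The blocks of `A`, given by the primitive central idempotents of `A` (the block itself, as a
two-sided ideal and an algebra, is `A e`). -/
def Block (A : Type u) [Ring A] : Type u :=
  {e : A // e ∈ Subring.center A ∧ IsIdempotentElem e ∧ e ≠ 0 ∧
    ∀ f ∈ Subring.center A, IsIdempotentElem f → f * e = f → f = 0 ∨ f = e}

/-- The module `M` belongs to the block `b`: the idempotent of `b` acts on `M` as the identity. -/
def Block.Contains {A : Type u} [Ring A] (b : Block A) (M : Type*) [AddCommGroup M] [Module A M] :
    Prop :=
  ∀ x : M, b.1 • x = x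

end Blocks

section HomQuiver

variable (k : Type w) [Field k] {A : Type u} [Ring A] [Algebra k A]
  {W : Type v} [PartialOrder W]

/-- The vertices of the `Hom` quiver between standards: the labels of the standard modules. -/
@[nolint unusedArguments]
def HomQuiver (_k : Type w) {A : Type u} [Ring A] {W : Type v} (_L _P : W → ModuleCat.{u} A) :
    Type v := W

/-- The number of arrows from `l` to `m` is the `k`-dimension of `Hom_A(Δ(l), Δ(m))`. -/
instance (L P : W → ModuleCat.{u} A) : Quiver (HomQuiver k L P) where
  Hom (l m : W) := Fin (Module.finrank k (standard L P l ⟶ standard L P m))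

/-- The connected component of the `Hom` quiver that contains the vertex `Δ(l)`. -/
def homComponent (L P : W → ModuleCat.{u} A) (l : W) :
    Quiver.WeaklyConnectedComponent (HomQuiver k L P) :=
  Quiver.WeaklyConnectedComponent.mk (show HomQuiver k L P from l)

end HomQuiver

end QuasiHered

/-!
The simple module `L(l)` is a composition factor of `M` if and only if there is a nonzero
homomorphism `P(l) → M`. Hence a nonzero homomorphism `P(l) → P(m)` makes `L(l)` a composition
factor of some section `Δ(t)` of the standard filtration of `P(m)`.

The duality enters through Brauer-Humphreys reciprocity: if `Δ(t)` is a section of `P(l)`, then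
`L(l)` is a composition factor of `Δ(t)`. Let `X` be the quotient of `P(l)` by the trace of the
`P(r)` with `r > t`. It has `L(t)`, but no `L(r)` with `r > t`, as a composition factor. The same
holds for the dual of `X`, which therefore receives a nonzero homomorphism from `Δ(t)`. Since `X`
has simple head `L(l)`, its dual has simple socle `L(l)`, so `L(l)` occurs in the image of `Δ(t)`.

By induction on `t`, a composition factor `L(l)` of `Δ(t)` is linked to `t` by homomorphisms between
standard modules: the image of `P(l) → Δ(t)` contains a nonzero image of some section `Δ(s)` of
`P(l)`, where either `s < t` and reciprocity applies to `s`, or `s = t = l`.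

Consequently a linkage class `C` is closed under nonzero homomorphisms between the `P(r)`. Then `A`
is the direct sum of the traces of the `P(r)` with `r ∈ C` and with `r ∉ C`, and the component of
`1` in the first summand is a central idempotent separating `C` from its complement.
-/

namespace QuasiHered

section CompositionFactors

variable {A : Type*} [Ring A] {M N S T : Type*} [AddCommGroup M] [Module A M] [AddCommGroup N]
  [Module A N] [AddCommGroup S] [Module A S] [AddCommGroup T] [Module A T]

theorem isCompFactor_iff_exists_surjective :
    IsCompFactor A M S ↔
      IsSimpleModule A S ∧ ∃ (V : Submodule A M) (g : V →ₗ[A] S), Function.Surjective g := by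
  refine and_congr_right fun _ => ⟨?_, ?_⟩
  · rintro ⟨U, V, -, ⟨e⟩⟩
    exact ⟨V, e.toLinearMap ∘ₗ (U.submoduleOf V).mkQ,
      e.surjective.comp (Submodule.mkQ_surjective _)⟩
  · rintro ⟨V, g, hg⟩
    have hker : ((LinearMap.ker g).map V.subtype).submoduleOf V = LinearMap.ker g :=
      Submodule.comap_map_eq_of_injective V.subtype_injective _
    exact ⟨(LinearMap.ker g).map V.subtype, V, Submodule.map_subtype_le _ _,
      ⟨(Submodule.quotEquivOfEq _ _ hker).trans (g.quotKerEquivOfSurjective hg)⟩⟩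

theorem isCompFactor_of_surjective_simple [IsSimpleModule A S] (f : M →ₗ[A] S)
    (hf : Function.Surjective f) : IsCompFactor A M S :=
  isCompFactor_iff_exists_surjective.2 ⟨inferInstance, ⊤, f ∘ₗ Submodule.topEquiv.toLinearMap,
    hf.comp Submodule.topEquiv.surjective⟩

theorem IsCompFactor.of_injective (h : IsCompFactor A M S) (f : M →ₗ[A] N)
    (hf : Function.Injective f) : IsCompFactor A N S := by
  obtain ⟨hS, V, g, hg⟩ := isCompFactor_iff_exists_surjective.1 h
  let e := Submodule.equivMapOfInjective f hf V
  exact isCompFactor_iff_exists_surjective.2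
    ⟨hS, V.map f, g ∘ₗ e.symm.toLinearMap, hg.comp e.symm.surjective⟩

theorem IsCompFactor.of_surjective (h : IsCompFactor A N S) (f : M →ₗ[A] N)
    (hf : Function.Surjective f) : IsCompFactor A M S := by
  obtain ⟨hS, V, g, hg⟩ := isCompFactor_iff_exists_surjective.1 h
  refine isCompFactor_iff_exists_surjective.2
    ⟨hS, V.comap f, g ∘ₗ f.restrict fun _ hx => hx, hg.comp ?_⟩
  rintro ⟨y, hy⟩
  obtain ⟨x, rfl⟩ := hf y
  exact ⟨⟨x, hy⟩, rfl⟩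

theorem IsCompFactor.exists_injective_quotient (h : IsCompFactor A M S) :
    ∃ (U : Submodule A M) (j : S →ₗ[A] M ⧸ U), Function.Injective j := by
  obtain ⟨-, U, V, -, ⟨e⟩⟩ := h
  have hker : LinearMap.ker (U.mkQ ∘ₗ V.subtype) = U.submoduleOf V := by
    rw [LinearMap.ker_comp, Submodule.ker_mkQ, Submodule.submoduleOf]
  have hinj : Function.Injective ((U.submoduleOf V).liftQ _ hker.ge) :=
    LinearMap.ker_eq_bot.1 (Submodule.ker_liftQ_eq_bot _ _ hker.ge hker.le)
  exact ⟨U, (U.submoduleOf V).liftQ _ hker.ge ∘ₗ e.symm.toLinearMap, hinj.comp e.symm.injective⟩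

theorem IsCompFactor.nonempty_equiv [IsSimpleModule A T] (h : IsCompFactor A T S) :
    Nonempty (T ≃ₗ[A] S) := by
  obtain ⟨hS, V, g, hg⟩ := isCompFactor_iff_exists_surjective.1 h
  have : Nontrivial S := IsSimpleModule.nontrivial A S
  have : Nontrivial V := hg.nontrivial
  obtain rfl : V = ⊤ := (eq_bot_or_eq_top V).resolve_left (Submodule.nontrivial_iff_ne_bot.1 this)
  have hf : Function.Surjective (g ∘ₗ (Submodule.topEquiv (R := A) (M := T)).symm.toLinearMap) :=
    hg.comp Submodule.topEquiv.symm.surjective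
  exact ⟨LinearEquiv.ofBijective _
    (LinearMap.bijective_of_ne_zero (LinearMap.ne_zero_of_surjective hf))⟩

end CompositionFactors

section Projective

variable {A : Type*} [Ring A] {Q M N : Type*} [AddCommGroup Q] [Module A Q] [Module.Projective A Q]
  [AddCommGroup M] [Module A M] [AddCommGroup N] [Module A N]

theorem exists_range_sub_comp_le {U : Submodule A M} {q : N →ₗ[A] M} {g : Q →ₗ[A] M}
    (hg : LinearMap.range g ≤ U ⊔ LinearMap.range q) :
    ∃ s : Q →ₗ[A] N, LinearMap.range (g - q ∘ₗ s) ≤ U := by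
  have hrange : LinearMap.range g ≤ LinearMap.range (U.subtype.coprod q) := by
    rwa [LinearMap.range_coprod, Submodule.range_subtype]
  obtain ⟨s, hs⟩ := Module.projective_lifting_property (U.subtype.coprod q).rangeRestrict
    (g.codRestrict _ fun x => hrange ⟨x, rfl⟩) (LinearMap.surjective_rangeRestrict _)
  refine ⟨LinearMap.snd A U N ∘ₗ s, ?_⟩
  rintro _ ⟨x, rfl⟩
  have hx : (s x).1 + q (s x).2 = g x := congrArg Subtype.val (LinearMap.congr_fun hs x)
  simp [← hx]

theorem eq_zero_of_range_le_iSup {ι : Type*} {p : ι → Submodule A M}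
    (hp : ∀ i, ∀ f : Q →ₗ[A] p i, f = 0) {g : Q →ₗ[A] M} (hg : LinearMap.range g ≤ ⨆ i, p i) :
    g = 0 := by
  classical
  let σ : (Π₀ i, p i) →ₗ[A] M := DFinsupp.lsum ℕ fun i => (p i).subtype
  have hrange : LinearMap.range g ≤ LinearMap.range σ := by
    rwa [← Submodule.iSup_eq_range_dfinsupp_lsum]
  obtain ⟨s, hs⟩ := Module.projective_lifting_property σ.rangeRestrict
    (g.codRestrict _ fun x => hrange ⟨x, rfl⟩) (LinearMap.surjective_rangeRestrict _)
  have hs0 : s = 0 := LinearMap.ext fun x => DFinsupp.ext fun i =>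
    LinearMap.congr_fun (hp i (DFinsupp.lapply i ∘ₗ s)) x
  ext x
  simpa [hs0] using (congrArg Subtype.val (LinearMap.congr_fun hs x)).symm

end Projective

namespace IsProjectiveCover

variable {A : Type*} [Ring A] {P S M : Type*} [AddCommGroup P] [Module A P] [AddCommGroup S]
  [Module A S] [AddCommGroup M] [Module A M] [IsSimpleModule A S]

theorem exists_head (hP : IsProjectiveCover A P S) [Nontrivial M] (f : P →ₗ[A] M)
    (hf : Function.Surjective f) :
    ∃ p : M →ₗ[A] S, Function.Surjective p ∧ ∀ N : Submodule A M, N ≠ ⊤ → N ≤ LinearMap.ker p := by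
  obtain ⟨-, π, hπ, hsmall⟩ := hP
  have hcoatom := LinearMap.isCoatom_ker_of_surjective hπ
  have hle : ∀ N : Submodule A P, N ≠ ⊤ → N ≤ LinearMap.ker π := fun N hN => by
    by_contra hNπ
    exact hN (hsmall N (hcoatom.2 _ (right_lt_sup.2 hNπ)))
  have hker : LinearMap.ker f ≤ LinearMap.ker π :=
    hle _ fun h0 => LinearMap.ne_zero_of_surjective hf (LinearMap.ker_eq_top.1 h0)
  let e := f.quotKerEquivOfSurjective hf
  let p : M →ₗ[A] S := (LinearMap.ker f).liftQ π hker ∘ₗ e.symm.toLinearMap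
  have hpf : ∀ x, p (f x) = π x := fun x => by
    have : e.symm (f x) = (LinearMap.ker f).mkQ x := e.symm_apply_eq.2 rfl
    simp [p, this]
  refine ⟨p, fun y => (hπ y).imp' f fun x hx => (hpf x).trans hx, fun N hN y hy => ?_⟩
  obtain ⟨x, rfl⟩ := hf y
  rw [LinearMap.mem_ker, hpf]
  refine hle (N.comap f) (fun htop => hN ?_) hy
  rw [← Submodule.map_comap_eq_of_surjective hf N, htop, Submodule.map_top,
    LinearMap.range_eq_top.2 hf]

theorem nontrivial (hP : IsProjectiveCover A P S) : Nontrivial P := by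
  obtain ⟨-, π, hπ, -⟩ := hP
  have := IsSimpleModule.nontrivial A S
  exact hπ.nontrivial

theorem exists_span_singleton_eq_top (hP : IsProjectiveCover A P S) :
    ∃ p : P →ₗ[A] S, p ≠ 0 ∧ ∀ x, p x ≠ 0 → Submodule.span A {x} = ⊤ := by
  have := hP.nontrivial
  have := IsSimpleModule.nontrivial A S
  obtain ⟨p, hp, hle⟩ := hP.exists_head LinearMap.id Function.surjective_id
  refine ⟨p, LinearMap.ne_zero_of_surjective hp, fun x hx => ?_⟩
  by_contra hne
  exact hx (hle _ hne (Submodule.mem_span_singleton_self x))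

theorem finite (hP : IsProjectiveCover A P S) : Module.Finite A P := by
  obtain ⟨p, hp, hspan⟩ := hP.exists_span_singleton_eq_top
  obtain ⟨x, hx⟩ := DFunLike.ne_iff.1 hp
  exact ⟨⟨{x}, by simpa using hspan x hx⟩⟩

theorem isCompFactor_iff (hP : IsProjectiveCover A P S) :
    IsCompFactor A M S ↔ ∃ f : P →ₗ[A] M, f ≠ 0 := by
  rw [isCompFactor_iff_exists_surjective]
  constructor
  · rintro ⟨-, V, g, hg⟩
    obtain ⟨hproj, π, hπ, -⟩ := hP
    have := IsSimpleModule.nontrivial A S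
    obtain ⟨f, hf⟩ := Module.projective_lifting_property g π hg
    refine ⟨V.subtype ∘ₗ f, fun h0 => LinearMap.ne_zero_of_surjective hπ ?_⟩
    have hf0 : f = 0 := LinearMap.ext fun x => Subtype.ext (LinearMap.congr_fun h0 x)
    rw [← hf, hf0, LinearMap.comp_zero]
  · rintro ⟨f, hf⟩
    have : Nontrivial (LinearMap.range f) :=
      Submodule.nontrivial_iff_ne_bot.2 (mt LinearMap.range_eq_bot.1 hf)
    obtain ⟨g, hg, -⟩ := hP.exists_head f.rangeRestrict f.surjective_rangeRestrict
    exact ⟨inferInstance, LinearMap.range f, g, hg⟩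

end IsProjectiveCover

section Trace

variable {A : Type u} [Ring A] {W : Type v} {M : Type*} [AddCommGroup M] [Module A M]

/-- The trace of the modules `P r`, `r ∈ C`, in the submodule `N` of `M`: the sum of the images of
all homomorphisms `P r → N`. -/
def trace (P : W → ModuleCat.{u} A) (C : Set W) (N : Submodule A M) : Submodule A M :=
  sSup {R | R ≤ N ∧ ∃ r ∈ C, ∃ g : P r →ₗ[A] M, LinearMap.range g = R}

variable {P : W → ModuleCat.{u} A} {C : Set W} {N : Submodule A M}

theorem trace_le_iff {K : Submodule A M} :
    trace P C N ≤ K ↔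
      ∀ r ∈ C, ∀ g : P r →ₗ[A] M, LinearMap.range g ≤ N → LinearMap.range g ≤ K := by
  rw [trace, sSup_le_iff]
  constructor
  · exact fun h r hr g hg => h _ ⟨hg, r, hr, g, rfl⟩
  · rintro h _ ⟨hg, r, hr, g, rfl⟩
    exact h r hr g hg

theorem range_le_trace {r : W} (hr : r ∈ C) {g : P r →ₗ[A] M} (hg : LinearMap.range g ≤ N) :
    LinearMap.range g ≤ trace P C N :=
  le_sSup ⟨hg, r, hr, g, rfl⟩

theorem trace_le : trace P C N ≤ N :=
  trace_le_iff.2 fun _ _ _ hg => hg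

theorem eq_zero_of_range_le_trace {Q : Type*} [AddCommGroup Q] [Module A Q] [Module.Projective A Q]
    (hQ : ∀ r ∈ C, ∀ f : Q →ₗ[A] P r, f = 0) {g : Q →ₗ[A] M}
    (hg : LinearMap.range g ≤ trace P C N) : g = 0 := by
  rw [trace, sSup_eq_iSup'] at hg
  refine eq_zero_of_range_le_iSup ?_ hg
  rintro ⟨_, -, r, hr, h, rfl⟩ f
  obtain ⟨s, rfl⟩ :=
    Module.projective_lifting_property h.rangeRestrict f h.surjective_rangeRestrict
  rw [hQ r hr s, LinearMap.comp_zero]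

end Trace

/-- `L` lists the simple modules up to isomorphism and `P` their projective covers. -/
structure IsProjectiveLabelling {A : Type u} [Ring A] {W : Type v} (L P : W → ModuleCat.{u} A) :
    Prop where
  labelling : IsSimpleLabelling L
  cover : ∀ l, IsProjectiveCover A (P l) (L l)

namespace IsProjectiveLabelling

variable {A : Type u} [Ring A] {W : Type v} {L P : W → ModuleCat.{u} A}

theorem simple (h : IsProjectiveLabelling L P) (l : W) : IsSimpleModule A (L l) :=
  h.labelling.simple l

theorem projective (h : IsProjectiveLabelling L P) (l : W) : Module.Projective A (P l) :=
  (h.cover l).1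

theorem isCompFactor_iff (h : IsProjectiveLabelling L P) {l : W} {M : Type*} [AddCommGroup M]
    [Module A M] : IsCompFactor A M (L l) ↔ ∃ f : P l →ₗ[A] M, f ≠ 0 :=
  have := h.simple l
  (h.cover l).isCompFactor_iff

theorem eq_of_isCompFactor_simple (h : IsProjectiveLabelling L P) {l m : W}
    (hc : IsCompFactor A (L m) (L l)) : l = m :=
  have := h.simple m
  hc.nonempty_equiv.elim fun e => h.labelling.irredundant l m ⟨e.symm⟩

theorem exists_isCompFactor (h : IsProjectiveLabelling L P) (M : Type u) [AddCommGroup M]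
    [Module A M] [Nontrivial M] : ∃ l, IsCompFactor A M (L l) := by
  obtain ⟨x, hx⟩ := exists_ne (0 : M)
  have : Nontrivial (Submodule.span A {x}) :=
    Submodule.nontrivial_iff_ne_bot.2 (by simpa using hx)
  obtain ⟨N, hN, -⟩ := (eq_top_or_exists_le_coatom
    (⊥ : Submodule A (Submodule.span A {x}))).resolve_left bot_ne_top
  obtain ⟨l, ⟨e⟩⟩ := h.labelling.complete _ (isSimpleModule_iff_isCoatom.2 hN)
  exact ⟨l, isCompFactor_iff_exists_surjective.2
    ⟨h.simple l, _, e.toLinearMap ∘ₗ N.mkQ, e.surjective.comp N.mkQ_surjective⟩⟩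

theorem not_isCompFactor_quotient_trace (h : IsProjectiveLabelling L P) {M : Type*}
    [AddCommGroup M] [Module A M] {C : Set W} {r : W} (hr : r ∈ C) :
    ¬ IsCompFactor A (M ⧸ trace P C (⊤ : Submodule A M)) (L r) := by
  rw [h.isCompFactor_iff]
  rintro ⟨f, hf⟩
  have := h.projective r
  obtain ⟨g, rfl⟩ := Module.projective_lifting_property _ f (Submodule.mkQ_surjective _)
  refine hf (LinearMap.range_le_ker_iff.1 ?_)
  rw [Submodule.ker_mkQ]
  exact range_le_trace hr le_top

theorem trace_sup_trace_compl (h : IsProjectiveLabelling L P) (M : Type u) [AddCommGroup M]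
    [Module A M] (C : Set W) :
    trace P C (⊤ : Submodule A M) ⊔ trace P Cᶜ (⊤ : Submodule A M) = ⊤ := by
  by_contra hne
  have := Submodule.Quotient.nontrivial_iff.2 hne
  obtain ⟨l, hl⟩ := h.exists_isCompFactor (M ⧸ trace P C ⊤ ⊔ trace P Cᶜ (⊤ : Submodule A M))
  by_cases hlC : l ∈ C
  · exact h.not_isCompFactor_quotient_trace hlC
      (hl.of_surjective (Submodule.factor le_sup_left) (Submodule.factor_surjective _))
  · exact h.not_isCompFactor_quotient_trace (C := Cᶜ) hlC
      (hl.of_surjective (Submodule.factor le_sup_right) (Submodule.factor_surjective _))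

end IsProjectiveLabelling

section Standard

variable {A : Type u} [Ring A] {W : Type v} [PartialOrder W] {L P : W → ModuleCat.{u} A}

namespace IsProjectiveLabelling

theorem le_of_isCompFactor_standard (h : IsProjectiveLabelling L P) {l m : W}
    (hm : IsCompFactor A (standard L P l) (L m)) : m ≤ l := by
  obtain ⟨f, hf⟩ := h.isCompFactor_iff.1 hm
  have := h.projective m
  obtain ⟨g, rfl⟩ := Module.projective_lifting_property _ f (standardKernel L P l).mkQ_surjective
  by_contra hml
  refine hf (LinearMap.range_le_ker_iff.1 ?_)
  rw [Submodule.ker_mkQ]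
  refine le_sInf fun U hU => ?_
  by_contra hle
  refine hml (hU m (h.isCompFactor_iff.2 ⟨U.mkQ ∘ₗ g, fun h0 => hle ?_⟩))
  rwa [← U.ker_mkQ, LinearMap.range_le_ker_iff]

theorem standardKernel_ne_top (h : IsProjectiveLabelling L P) (l : W) :
    standardKernel L P l ≠ ⊤ := by
  have := h.simple l
  obtain ⟨-, π, hπ, -⟩ := h.cover l
  refine ne_top_of_le_ne_top (LinearMap.isCoatom_ker_of_surjective hπ).1 (sInf_le fun m hm => ?_)
  let e := π.quotKerEquivOfSurjective hπ
  exact (h.eq_of_isCompFactor_simple (hm.of_injective e.toLinearMap e.injective)).le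

theorem eq_top_of_isCompFactor (h : IsProjectiveLabelling L P) (hA : IsQuasiHereditary L P)
    {l : W} {N : Submodule A (standard L P l)} (hN : IsCompFactor A N (L l)) : N = ⊤ := by
  have := h.simple l
  have : Nontrivial (standard L P l) :=
    Submodule.Quotient.nontrivial_iff.2 (h.standardKernel_ne_top l)
  obtain ⟨p, hp, hle⟩ := (h.cover l).exists_head (standardKernel L P l).mkQ
    (Submodule.mkQ_surjective _)
  by_contra hne
  exact lt_irrefl l (hA.radical_lt l p hp l
    (hN.of_injective (Submodule.inclusion (hle N hne)) (Submodule.inclusion_injective _)))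

end IsProjectiveLabelling

/-- The section `N' / N` of `M` is isomorphic to `Δ(m)`, expressed by a homomorphism `q : P m → N'`
that induces an isomorphism `Δ(m) → N' / N`. -/
def IsStandardSection (L P : W → ModuleCat.{u} A) {M : Type*} [AddCommGroup M] [Module A M]
    (N N' : Submodule A M) (m : W) : Prop :=
  ∃ q : P m →ₗ[A] M, N ⊔ LinearMap.range q = N' ∧ N.comap q = standardKernel L P m

namespace IsStandardSection

variable {M X : Type*} [AddCommGroup M] [Module A M] [AddCommGroup X] [Module A X]
  {N N' : Submodule A M} {m t : W}

theorem of_equiv (h : IsProjectiveLabelling L P) (hN : N ≤ N')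
    (e : (N' ⧸ N.submoduleOf N') ≃ₗ[A] standard L P m) : IsStandardSection L P N N' m := by
  have := h.projective m
  obtain ⟨q, hq⟩ := Module.projective_lifting_property (N.submoduleOf N').mkQ
    (e.symm.toLinearMap ∘ₗ (standardKernel L P m).mkQ) (Submodule.mkQ_surjective _)
  have hmk : ∀ x, (N.submoduleOf N').mkQ (q x) = e.symm ((standardKernel L P m).mkQ x) :=
    LinearMap.congr_fun hq
  refine ⟨N'.subtype ∘ₗ q, le_antisymm (sup_le hN ?_) fun y hy => ?_, ?_⟩
  · rintro _ ⟨x, rfl⟩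
    exact (q x).2
  · obtain ⟨x, hx⟩ := (e.symm.surjective.comp (standardKernel L P m).mkQ_surjective)
      ((N.submoduleOf N').mkQ ⟨y, hy⟩)
    have hyx : y - q x ∈ N :=
      (Submodule.Quotient.eq (N.submoduleOf N')).1 (hx.symm.trans (hmk x).symm)
    rw [← sub_add_cancel y (q x : M)]
    exact Submodule.add_mem_sup hyx ⟨x, rfl⟩
  · calc N.comap (N'.subtype ∘ₗ q)
        = LinearMap.ker ((N.submoduleOf N').mkQ ∘ₗ q) := by
          rw [LinearMap.ker_comp, Submodule.ker_mkQ, Submodule.submoduleOf, Submodule.comap_comp]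
      _ = standardKernel L P m := by
          rw [hq, LinearEquiv.ker_comp, Submodule.ker_mkQ]

theorem le (hs : IsStandardSection L P N N' m) : N ≤ N' := by
  obtain ⟨q, rfl, -⟩ := hs
  exact le_sup_left

theorem isCompFactor_standard (h : IsProjectiveLabelling L P) (hs : IsStandardSection L P N N' m)
    {r : W} {g : P r →ₗ[A] M} (hg : LinearMap.range g ≤ N') (hgN : ¬ LinearMap.range g ≤ N) :
    IsCompFactor A (standard L P m) (L r) := by
  obtain ⟨q, rfl, hq⟩ := hs
  have := h.projective r
  obtain ⟨s, hs⟩ := exists_range_sub_comp_le hg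
  refine h.isCompFactor_iff.2 ⟨(standardKernel L P m).mkQ ∘ₗ s, fun h0 => hgN ?_⟩
  rw [← LinearMap.range_le_ker_iff, Submodule.ker_mkQ, ← hq] at h0
  rintro _ ⟨x, rfl⟩
  rw [← sub_add_cancel (g x) (q (s x))]
  exact N.add_mem (hs ⟨x, rfl⟩) (h0 ⟨x, rfl⟩)

theorem exists_hom_standard (hs : IsStandardSection L P N N' m) {f : M →ₗ[A] X}
    (hN : N ≤ LinearMap.ker f) (hN' : ¬ N' ≤ LinearMap.ker f) :
    ∃ g : standard L P m →ₗ[A] X, g ≠ 0 ∧ LinearMap.range g ≤ LinearMap.range f := by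
  obtain ⟨q, rfl, hq⟩ := hs
  have hker : standardKernel L P m ≤ LinearMap.ker (f ∘ₗ q) := by
    rw [← hq, LinearMap.ker_comp]
    exact Submodule.comap_mono hN
  refine ⟨(standardKernel L P m).liftQ (f ∘ₗ q) hker, fun h0 => hN' (sup_le hN ?_), ?_⟩
  · rw [LinearMap.range_le_ker_iff, ← Submodule.liftQ_mkQ _ _ hker, h0, LinearMap.zero_comp]
  · rw [Submodule.range_liftQ]
    exact LinearMap.range_comp_le_range q f

end IsStandardSection

theorem IsProjectiveLabelling.standardKernel_eq_trace (h : IsProjectiveLabelling L P)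
    (hA : IsQuasiHereditary L P) (l : W) : standardKernel L P l = trace P (Set.Ioi l) ⊤ := by
  apply le_antisymm
  · obtain ⟨n, F, hF, h0, hn, hs⟩ := hA.filtration l
    have hle : ∀ i ≤ n, F i ≤ trace P (Set.Ioi l) ⊤ := by
      intro i hi
      induction i with
      | zero => exact h0.trans_le bot_le
      | succ i ih =>
        obtain ⟨m, hm, ⟨e⟩⟩ := hs i hi
        obtain ⟨q, hq, -⟩ := IsStandardSection.of_equiv h (hF i.le_succ) e
        exact hq ▸ sup_le (ih (Nat.le_of_succ_le hi)) (range_le_trace hm le_top)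
    exact hn ▸ hle n le_rfl
  · refine trace_le_iff.2 fun r hr g _ => ?_
    rw [← (standardKernel L P l).ker_mkQ, LinearMap.range_le_ker_iff]
    by_contra hg
    exact (h.le_of_isCompFactor_standard (h.isCompFactor_iff.2 ⟨_, hg⟩)).not_gt hr

end Standard

section StandardFiltration

theorem exists_step_of_reflTransGen {α : Type*} {r : α → α → Prop} {p : α → Prop} {a b : α}
    (h : Relation.ReflTransGen r a b) (ha : p a) (hb : ¬ p b) :
    ∃ c d, Relation.ReflTransGen r a c ∧ p c ∧ r c d ∧ ¬ p d ∧ Relation.ReflTransGen r d b := by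
  induction h with
  | refl => exact (hb ha).elim
  | @tail b' b hab hbb ih =>
    by_cases hb' : p b'
    · exact ⟨b', b, hab, hb', hbb, hb, .refl⟩
    · obtain ⟨c, d, hac, hc, hcd, hd, hdb⟩ := ih hb'
      exact ⟨c, d, hac, hc, hcd, hd, hdb.tail hbb⟩

variable {A : Type u} [Ring A] {W : Type v} [PartialOrder W]

/-- There is a finite filtration from `N` up to `N'` all of whose sections are standard modules. -/
def IsStandardlyFiltered (L P : W → ModuleCat.{u} A) {M : Type*} [AddCommGroup M] [Module A M]
    (N N' : Submodule A M) : Prop :=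
  Relation.ReflTransGen (fun N N' => ∃ m, IsStandardSection L P N N' m) N N'

/-- `Δ(t)` occurs as a section in a finite filtration of `M` by standard modules. -/
def HasStandardSection (L P : W → ModuleCat.{u} A) (M : Type*) [AddCommGroup M] [Module A M]
    (t : W) : Prop :=
  ∃ N N' : Submodule A M,
    IsStandardlyFiltered L P ⊥ N ∧ IsStandardSection L P N N' t ∧ IsStandardlyFiltered L P N' ⊤

variable {L P : W → ModuleCat.{u} A} {M X : Type*} [AddCommGroup M] [Module A M]
  [AddCommGroup X] [Module A X] {N N' : Submodule A M} {m t : W}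

theorem IsStandardSection.inf_trace_le (h : IsProjectiveLabelling L P)
    (hA : IsQuasiHereditary L P) (hs : IsStandardSection L P N N' m) (t : W) :
    N ⊓ trace P (Set.Ioi t) N' ≤ trace P (Set.Ioi t) N := by
  by_cases htm : t < m
  · obtain ⟨q, rfl, hq⟩ := hs
    have hle : trace P (Set.Ioi t) (N ⊔ LinearMap.range q) ≤
        trace P (Set.Ioi t) N ⊔ LinearMap.range q := by
      refine trace_le_iff.2 fun r hr g hg => ?_
      have := h.projective r
      obtain ⟨s, hs⟩ := exists_range_sub_comp_le hg
      rintro _ ⟨x, rfl⟩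
      rw [← sub_add_cancel (g x) (q (s x))]
      exact Submodule.add_mem_sup (range_le_trace hr hs ⟨x, rfl⟩) ⟨s x, rfl⟩
    have hker : N.comap q ≤ (trace P (Set.Ioi t) N).comap q := by
      rw [hq, h.standardKernel_eq_trace hA]
      refine trace_le_iff.2 fun r hr g _ => ?_
      rw [← Submodule.map_le_iff_le_comap, ← LinearMap.range_comp]
      refine range_le_trace (htm.trans hr) ?_
      rw [LinearMap.range_comp, Submodule.map_le_iff_le_comap, hq, h.standardKernel_eq_trace hA]
      exact range_le_trace hr le_top
    rintro y ⟨hyN, hyT⟩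
    obtain ⟨a, ha, _, ⟨x, rfl⟩, rfl⟩ := Submodule.mem_sup.1 (hle hyT)
    exact add_mem ha (hker ((Submodule.add_mem_iff_right N (trace_le ha)).1 hyN))
  · refine inf_le_right.trans (trace_le_iff.2 fun r hr g hg => range_le_trace hr ?_)
    by_contra hgN
    exact htm (hr.trans_le (h.le_of_isCompFactor_standard (hs.isCompFactor_standard h hg hgN)))

theorem IsStandardSection.trace_le (h : IsProjectiveLabelling L P)
    (hs : IsStandardSection L P N N' t) : trace P (Set.Ioi t) N' ≤ N := by
  refine trace_le_iff.2 fun r hr g hg => ?_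
  by_contra hgN
  exact (h.le_of_isCompFactor_standard (hs.isCompFactor_standard h hg hgN)).not_gt hr

theorem IsStandardlyFiltered.inf_trace_le (h : IsProjectiveLabelling L P)
    (hA : IsQuasiHereditary L P) (hN : IsStandardlyFiltered L P N N') (t : W) :
    N ⊓ trace P (Set.Ioi t) N' ≤ trace P (Set.Ioi t) N := by
  induction hN using Relation.ReflTransGen.head_induction_on with
  | refl => exact inf_le_right
  | head hs _ ih =>
    obtain ⟨m, hs⟩ := hs
    exact (le_inf inf_le_left ((inf_le_inf_right _ hs.le).trans ih)).trans
      (hs.inf_trace_le h hA t)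

theorem HasStandardSection.isCompFactor_quotient_trace (h : IsProjectiveLabelling L P)
    (hA : IsQuasiHereditary L P) (ht : HasStandardSection L P M t) :
    IsCompFactor A (M ⧸ trace P (Set.Ioi t) (⊤ : Submodule A M)) (L t) := by
  obtain ⟨N, N', -, hs, hN'⟩ := ht
  have hsN := hs.trace_le h
  obtain ⟨q, hq, hqN⟩ := hs
  refine h.isCompFactor_iff.2 ⟨Submodule.mkQ _ ∘ₗ q, fun h0 => h.standardKernel_ne_top t ?_⟩
  rw [← LinearMap.range_le_ker_iff, Submodule.ker_mkQ] at h0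
  have hqN' : LinearMap.range q ≤ N := calc
    LinearMap.range q ≤ N' ⊓ trace P (Set.Ioi t) ⊤ := le_inf (le_sup_right.trans hq.le) h0
    _ ≤ trace P (Set.Ioi t) N' := hN'.inf_trace_le h hA t
    _ ≤ N := hsN
  rw [← hqN, eq_top_iff]
  exact fun x _ => hqN' ⟨x, rfl⟩

theorem IsStandardlyFiltered.exists_isCompFactor (h : IsProjectiveLabelling L P)
    (hM : IsStandardlyFiltered L P (⊥ : Submodule A M) ⊤) {r : W} (hr : IsCompFactor A M (L r)) :
    ∃ t, HasStandardSection L P M t ∧ IsCompFactor A (standard L P t) (L r) := by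
  obtain ⟨f, hf⟩ := h.isCompFactor_iff.1 hr
  obtain ⟨N, N', hN, hfN, ⟨t, hs⟩, hfN', hN'⟩ :=
    exists_step_of_reflTransGen (p := fun N => ¬ LinearMap.range f ≤ N) hM
      (fun h0 => hf (LinearMap.range_eq_bot.1 (le_bot_iff.1 h0))) (not_not.2 le_top)
  exact ⟨t, ⟨N, N', hN, hs, hN'⟩, hs.isCompFactor_standard h (not_not.1 hfN') hfN⟩

theorem IsStandardlyFiltered.exists_hom_standard
    (hM : IsStandardlyFiltered L P (⊥ : Submodule A M) ⊤) {f : M →ₗ[A] X} (hf : f ≠ 0) :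
    ∃ t, HasStandardSection L P M t ∧
      ∃ g : standard L P t →ₗ[A] X, g ≠ 0 ∧ LinearMap.range g ≤ LinearMap.range f := by
  obtain ⟨N, N', hN, hfN, ⟨t, hs⟩, hfN', hN'⟩ :=
    exists_step_of_reflTransGen (p := fun N => N ≤ LinearMap.ker f) hM bot_le
      (fun h0 => hf (LinearMap.ker_eq_top.1 (top_le_iff.1 h0)))
  exact ⟨t, ⟨N, N', hN, hs, hN'⟩, hs.exists_hom_standard hfN hfN'⟩

theorem IsProjectiveLabelling.isStandardlyFiltered (h : IsProjectiveLabelling L P)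
    (hA : IsQuasiHereditary L P) (l : W) :
    IsStandardlyFiltered L P (⊥ : Submodule A (P l)) ⊤ := by
  obtain ⟨n, F, hF, h0, hn, hs⟩ := hA.filtration l
  have hkernel : ∀ i ≤ n, IsStandardlyFiltered L P ⊥ (F i) := by
    intro i hi
    induction i with
    | zero => exact h0 ▸ .refl
    | succ i ih =>
      obtain ⟨m, -, ⟨e⟩⟩ := hs i hi
      exact (ih (Nat.le_of_succ_le hi)).tail ⟨m, .of_equiv h (hF i.le_succ) e⟩
  have htop : IsStandardSection L P (standardKernel L P l) ⊤ l :=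
    ⟨LinearMap.id, by rw [LinearMap.range_id, sup_top_eq], Submodule.comap_id _⟩
  exact (hn ▸ hkernel n le_rfl).tail ⟨l, htop⟩

end StandardFiltration

section Duality

variable {A : Type u} [Ring A]

theorem fgModuleCat_mono_iff_injective [IsNoetherianRing A] {X Y : FGModuleCat.{u} A}
    (f : X ⟶ Y) : Mono f ↔ Function.Injective f.hom.hom :=
  ((forget₂ (FGModuleCat.{u} A) (ModuleCat.{u} A)).mono_map_iff_mono f).symm.trans
    (ModuleCat.mono_iff_injective _)

theorem fgModuleCat_epi_iff_surjective [IsNoetherianRing A] {X Y : FGModuleCat.{u} A}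
    (f : X ⟶ Y) : Epi f ↔ Function.Surjective f.hom.hom :=
  ((forget₂ (FGModuleCat.{u} A) (ModuleCat.{u} A)).epi_map_iff_epi f).symm.trans
    (ModuleCat.epi_iff_surjective _)

namespace Duality

/-- The dual of a finitely generated module. -/
abbrev obj (D : Duality A) (X : FGModuleCat.{u} A) : FGModuleCat.{u} A :=
  D.functor.obj (Opposite.op X)

/-- The dual of a homomorphism. -/
def map (D : Duality A) {X Y : FGModuleCat.{u} A} (f : X →ₗ[A] Y) : D.obj Y →ₗ[A] D.obj X :=
  (D.functor.map (Quiver.Hom.op (FGModuleCat.ofHom f : X ⟶ Y))).hom.hom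

variable (D : Duality A) {X Y : FGModuleCat.{u} A}

theorem exists_map_eq (g : D.obj Y →ₗ[A] D.obj X) : ∃ f : X →ₗ[A] Y, D.map f = g := by
  obtain ⟨f, hf⟩ := D.functor.map_surjective (FGModuleCat.ofHom g : D.obj Y ⟶ D.obj X)
  exact ⟨f.unop.hom.hom, congrArg (fun c => c.hom.hom) hf⟩

theorem exists_obj_equiv (V : Type u) [AddCommGroup V] [Module A V] [Module.Finite A V] :
    ∃ Z : FGModuleCat.{u} A, Nonempty (D.obj Z ≃ₗ[A] V) :=
  ⟨(D.functor.objPreimage (FGModuleCat.of A V)).unop,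
    ⟨FGModuleCat.isoToLinearEquiv (D.functor.objObjPreimageIso (FGModuleCat.of A V))⟩⟩

theorem nontrivial_of_nontrivial_obj [Nontrivial (D.obj X)] : Nontrivial X := by
  by_contra hX
  rw [not_nontrivial_iff_subsingleton] at hX
  obtain ⟨f, hf⟩ := D.exists_map_eq (1 : Module.End A (D.obj X))
  obtain ⟨g, hg⟩ := D.exists_map_eq (0 : Module.End A (D.obj X))
  refine one_ne_zero (α := Module.End A (D.obj X)) ?_
  rw [← hf, ← hg, Subsingleton.elim f g]

variable [IsNoetherianRing A]

theorem map_surjective_iff (f : X →ₗ[A] Y) :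
    Function.Surjective (D.map f) ↔ Function.Injective f := by
  rw [map, ← fgModuleCat_epi_iff_surjective, D.functor.epi_map_iff_epi, op_epi_iff,
    fgModuleCat_mono_iff_injective]
  rfl

theorem map_injective_iff (f : X →ₗ[A] Y) :
    Function.Injective (D.map f) ↔ Function.Surjective f := by
  rw [map, ← fgModuleCat_mono_iff_injective, D.functor.mono_map_iff_mono, op_mono_iff,
    fgModuleCat_epi_iff_surjective]
  rfl

variable {D}

theorem SimplePreserving.isCompFactor_obj_iff (hD : D.SimplePreserving) {S : Type u}
    [AddCommGroup S] [Module A S] : IsCompFactor A (D.obj X) S ↔ IsCompFactor A X S := by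
  constructor <;> intro hS
  · have := hS.1
    obtain ⟨d⟩ := hD (FGModuleCat.of A S) hS.1
    obtain ⟨U, j, hj⟩ := hS.exists_injective_quotient
    obtain ⟨Z, ⟨e⟩⟩ := D.exists_obj_equiv (D.obj X ⧸ U)
    obtain ⟨a, ha⟩ := D.exists_map_eq (e.symm.toLinearMap ∘ₗ U.mkQ)
    obtain ⟨b, hb⟩ := D.exists_map_eq (e.symm.toLinearMap ∘ₗ j ∘ₗ d.toLinearMap)
    have ha' : Function.Injective a := by
      rw [← D.map_surjective_iff, ha]
      exact e.symm.surjective.comp U.mkQ_surjective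
    have hb' : Function.Surjective b := by
      rw [← D.map_injective_iff, hb]
      exact e.symm.injective.comp (hj.comp d.injective)
    exact (isCompFactor_of_surjective_simple b hb').of_injective a ha'
  · have := hS.1
    obtain ⟨d⟩ := hD (FGModuleCat.of A S) hS.1
    obtain ⟨U, j, hj⟩ := hS.exists_injective_quotient
    let Y := FGModuleCat.of A (X ⧸ U)
    have hmkQ : Function.Injective (D.map (Y := Y) U.mkQ) :=
      (D.map_injective_iff _).2 U.mkQ_surjective
    have hj' : Function.Surjective (D.map (X := FGModuleCat.of A S) (Y := Y) j) :=
      (D.map_surjective_iff _).2 hj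
    exact (isCompFactor_of_surjective_simple (d.toLinearMap ∘ₗ D.map (Y := Y) j)
      (d.surjective.comp hj')).of_injective _ hmkQ

/-- A simple head of `X` is dual to a simple socle of `D X`. -/
theorem SimplePreserving.isCompFactor_submodule (hD : D.SimplePreserving) {P : Type*}
    [AddCommGroup P] [Module A P] {S : Type u} [AddCommGroup S] [Module A S] [IsSimpleModule A S]
    (hP : IsProjectiveCover A P S) {p : P →ₗ[A] X} (hp : Function.Surjective p)
    {V : Submodule A (D.obj X)} (hV : V ≠ ⊥) : IsCompFactor A V S := by
  obtain ⟨Z, ⟨e⟩⟩ := D.exists_obj_equiv V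
  obtain ⟨a, ha⟩ := D.exists_map_eq (V.subtype ∘ₗ e.toLinearMap)
  have ha' : Function.Surjective a := by
    rw [← D.map_injective_iff, ha]
    exact V.subtype_injective.comp e.injective
  have : Nontrivial V := Submodule.nontrivial_iff_ne_bot.2 hV
  have : Nontrivial (D.obj Z) := e.toEquiv.nontrivial
  have := D.nontrivial_of_nontrivial_obj (X := Z)
  obtain ⟨g, hg, -⟩ := hP.exists_head (a ∘ₗ p) (ha'.comp hp)
  exact (hD.isCompFactor_obj_iff.2 (isCompFactor_of_surjective_simple g hg)).of_injective
    e.toLinearMap e.injective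

end Duality

/-- A qualitative form of Brauer-Humphreys reciprocity `(P(l) : Δ(t)) = [Δ(t) : L(l)]`. -/
theorem HasStandardSection.isCompFactor_standard [IsNoetherianRing A] {W : Type v} [PartialOrder W]
    {L P : W → ModuleCat.{u} A} (h : IsProjectiveLabelling L P) (hA : IsQuasiHereditary L P)
    {D : Duality A} (hD : D.SimplePreserving) {l t : W} (ht : HasStandardSection L P (P l) t) :
    IsCompFactor A (standard L P t) (L l) := by
  have := h.simple l
  have := (h.cover l).finite
  let X := FGModuleCat.of A (P l ⧸ trace P (Set.Ioi t) (⊤ : Submodule A (P l)))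
  obtain ⟨f, hf⟩ := h.isCompFactor_iff.1
    (hD.isCompFactor_obj_iff.2 (ht.isCompFactor_quotient_trace h hA) : IsCompFactor A (D.obj X) _)
  have hker : standardKernel L P t ≤ LinearMap.ker f := by
    rw [h.standardKernel_eq_trace hA, trace_le_iff]
    intro r hr g _
    rw [LinearMap.range_le_ker_iff]
    by_contra hfg
    exact h.not_isCompFactor_quotient_trace hr
      (hD.isCompFactor_obj_iff.1 (h.isCompFactor_iff.2 ⟨f ∘ₗ g, hfg⟩) : IsCompFactor A X _)
  have hsocle : IsCompFactor A (LinearMap.range f) (L l) :=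
    hD.isCompFactor_submodule (X := X) (h.cover l) (Submodule.mkQ_surjective _)
      (mt LinearMap.range_eq_bot.1 hf)
  refine hsocle.of_surjective
    ((standardKernel L P t).liftQ f.rangeRestrict (by rwa [LinearMap.ker_rangeRestrict])) ?_
  rw [← LinearMap.range_eq_top, Submodule.range_liftQ, LinearMap.range_rangeRestrict]

end Duality

section Linkage

variable {A : Type u} [Ring A] {W : Type v} [PartialOrder W]

/-- The linkage of labels: the equivalence relation on `W` generated by the nonzero homomorphisms
between standard modules. -/
def StandardLinked (L P : W → ModuleCat.{u} A) : W → W → Prop :=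
  Relation.EqvGen fun l m => ∃ f : standard L P l →ₗ[A] standard L P m, f ≠ 0

namespace IsProjectiveLabelling

variable {L P : W → ModuleCat.{u} A}

theorem isCompFactor_range_of_standard (h : IsProjectiveLabelling L P) {M : Type*}
    [AddCommGroup M] [Module A M] {l : W} {g : standard L P l →ₗ[A] M} (hg : g ≠ 0) :
    IsCompFactor A (LinearMap.range g) (L l) := by
  refine h.isCompFactor_iff.2
    ⟨g.rangeRestrict ∘ₗ (standardKernel L P l).mkQ, fun h0 => hg (Submodule.linearMap_qext _ ?_)⟩
  exact LinearMap.ext fun x => congrArg Subtype.val (LinearMap.congr_fun h0 x)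

variable [IsNoetherianRing A] [WellFoundedLT W]

theorem standardLinked_of_isCompFactor (h : IsProjectiveLabelling L P)
    (hA : IsQuasiHereditary L P) {D : Duality A} (hD : D.SimplePreserving) {l t : W}
    (hl : IsCompFactor A (standard L P t) (L l)) : StandardLinked L P l t := by
  induction t using WellFoundedLT.induction with
  | ind t ih =>
    obtain ⟨f, hf⟩ := h.isCompFactor_iff.1 hl
    obtain ⟨s, hs, g, hg, hgf⟩ := (h.isStandardlyFiltered hA l).exists_hom_standard hf
    have hrange := h.isCompFactor_range_of_standard hg
    have hst : s ≤ t := h.le_of_isCompFactor_standard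
      (hrange.of_injective _ (LinearMap.range g).subtype_injective)
    rcases hst.lt_or_eq with hlt | rfl
    · exact (ih s hlt (hs.isCompFactor_standard h hA hD)).trans _ _ _ (.rel _ _ ⟨g, hg⟩)
    · have hf' : Function.Surjective f := by
        rw [← LinearMap.range_eq_top, ← top_le_iff, ← h.eq_top_of_isCompFactor hA hrange]
        exact hgf
      have := h.simple l
      have := IsSimpleModule.nontrivial A (L l)
      have : Nontrivial (standard L P s) :=
        Submodule.Quotient.nontrivial_iff.2 (h.standardKernel_ne_top s)
      obtain ⟨p, hp, -⟩ := (h.cover l).exists_head f hf'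
      have hhead : IsCompFactor A (L l) (L s) := h.isCompFactor_iff.2
        ⟨p ∘ₗ (standardKernel L P s).mkQ,
          LinearMap.ne_zero_of_surjective (hp.comp (Submodule.mkQ_surjective _))⟩
      rw [h.eq_of_isCompFactor_simple hhead]
      exact .refl _

theorem standardLinked_of_hom_projective (h : IsProjectiveLabelling L P)
    (hA : IsQuasiHereditary L P) {D : Duality A} (hD : D.SimplePreserving) {l m : W}
    {f : P l →ₗ[A] P m} (hf : f ≠ 0) : StandardLinked L P l m := by
  obtain ⟨t, ht, hl⟩ :=
    (h.isStandardlyFiltered hA m).exists_isCompFactor h (h.isCompFactor_iff.2 ⟨f, hf⟩)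
  exact (h.standardLinked_of_isCompFactor hA hD hl).trans _ _ _
    ((h.standardLinked_of_isCompFactor hA hD (ht.isCompFactor_standard h hA hD)).symm _ _)

end IsProjectiveLabelling

theorem weaklyConnectedComponent_mk_eq_mk_iff {V : Type*} [Quiver V] {a b : V} :
    Quiver.WeaklyConnectedComponent.mk a = Quiver.WeaklyConnectedComponent.mk b ↔
      Relation.EqvGen (fun a b : V => Nonempty (a ⟶ b)) a b := by
  constructor
  · intro hab
    obtain ⟨p⟩ := (Quiver.WeaklyConnectedComponent.eq a b).1 hab
    clear hab
    induction p with
    | nil => exact .refl _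
    | cons _ e ih =>
      rcases e with e | e
      · exact ih.trans _ _ _ (.rel _ _ ⟨e⟩)
      · exact ih.trans _ _ _ ((Relation.EqvGen.rel _ _ ⟨e⟩).symm _ _)
  · intro hab
    induction hab with
    | rel a b e =>
      obtain ⟨e⟩ := e
      exact (Quiver.WeaklyConnectedComponent.eq a b).2
        ⟨Quiver.Hom.toPath (V := Quiver.Symmetrify V) (Sum.inl e)⟩
    | refl => rfl
    | symm _ _ _ ih => exact ih.symm
    | trans _ _ _ _ _ ih₁ ih₂ => exact ih₁.trans ih₂

variable {k : Type w} [Field k] [Algebra k A] [Module.Finite k A]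

open scoped ModuleCat in
theorem finite_moduleCat_hom (M N : ModuleCat.{u} A) [Module.Finite A M] [Module.Finite A N] :
    Module.Finite k (M ⟶ N) := by
  have : Module.Finite k M := .trans A M
  have : Module.Finite k N := .trans A N
  exact .of_injective
    (LinearMap.restrictScalarsₗ k A M N k ∘ₗ (ModuleCat.homLinearEquiv (S := k)).toLinearMap)
    ((LinearMap.restrictScalars_injective k).comp (ModuleCat.homLinearEquiv (S := k)).injective)

theorem homComponent_eq_iff_standardLinked {L P : W → ModuleCat.{u} A}
    (hP : ∀ l, Module.Finite A (P l)) {l m : W} :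
    homComponent k L P l = homComponent k L P m ↔ StandardLinked L P l m := by
  have harrow : ∀ r s : HomQuiver k L P,
      Nonempty (r ⟶ s) ↔ ∃ f : standard L P r →ₗ[A] standard L P s, f ≠ 0 := fun r s => by
    have := hP r
    have := hP s
    have hfin : Module.Finite k (standard L P r ⟶ standard L P s) := finite_moduleCat_hom _ _
    calc Nonempty (Fin (Module.finrank k (standard L P r ⟶ standard L P s)))
        ↔ Nontrivial (standard L P r ⟶ standard L P s) := by
          rw [← Fin.pos_iff_nonempty, Module.finrank_pos_iff]
      _ ↔ ∃ f : standard L P r →ₗ[A] standard L P s, f ≠ 0 := by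
          rw [ModuleCat.homEquiv.nontrivial_congr, nontrivial_iff_exists_ne 0]
  rw [homComponent, homComponent, weaklyConnectedComponent_mk_eq_mk_iff]
  simp only [harrow]
  rfl

end Linkage

section CentralIdempotents

variable {A : Type u} [Ring A]

theorem exists_central_idempotent_of_sup_eq_top {I J : Ideal A} (hsup : I ⊔ J = ⊤)
    (hIJ : ∀ x ∈ I, ∀ y ∈ J, x * y = 0) (hJI : ∀ x ∈ J, ∀ y ∈ I, x * y = 0) :
    ∃ c ∈ I, c ∈ Subring.center A ∧ IsIdempotentElem c ∧ 1 - c ∈ J := by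
  obtain ⟨c, hc, d, hd, hcd⟩ :=
    Submodule.mem_sup.1 (hsup ▸ Submodule.mem_top : (1 : A) ∈ I ⊔ J)
  have hleft : ∀ a, c * (a * c) = a * c := fun a => by
    rw [← add_zero (c * (a * c)), ← hJI d hd _ (I.mul_mem_left a hc), ← add_mul, hcd, one_mul]
  have hright : ∀ a, c * (a * c) = c * a := fun a => by
    rw [← add_zero (c * (a * c)), ← hIJ c hc _ (J.mul_mem_left a hd), ← mul_add, ← mul_add, hcd,
      mul_one]
  have hidem : c * c = c := by simpa only [one_mul] using hleft 1
  exact ⟨c, hc, Subring.mem_center_iff.2 fun a => (hleft a).symm.trans (hright a), hidem,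
    eq_sub_of_add_eq' hcd ▸ hd⟩

theorem IsProjectiveCover.central_idempotent_smul {P S : Type*} [AddCommGroup P] [Module A P]
    [AddCommGroup S] [Module A S] [IsSimpleModule A S] (hP : IsProjectiveCover A P S) {c : A}
    (hc : c ∈ Subring.center A) (hci : IsIdempotentElem c) :
    (∀ x : P, c • x = x) ∨ ∀ x : P, c • x = 0 := by
  obtain ⟨p, hp, hspan⟩ := hP.exists_span_singleton_eq_top
  obtain ⟨x, hx⟩ := DFunLike.ne_iff.1 hp
  have hgen : ∀ z : P, p z ≠ 0 → ∀ y : P, ∃ a : A, a • z = y := fun z hz y =>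
    Submodule.mem_span_singleton.1 (hspan z hz ▸ Submodule.mem_top)
  by_cases hcx : p (c • x) = 0
  · right
    intro y
    have hdx : p ((1 - c) • x) ≠ 0 := by rwa [sub_smul, one_smul, map_sub, hcx, sub_zero]
    obtain ⟨a, rfl⟩ := hgen _ hdx y
    rw [smul_smul, smul_smul, ← Subring.mem_center_iff.1 hc a, mul_assoc, mul_sub, mul_one, hci.eq,
      sub_self, mul_zero, zero_smul]
  · left
    intro y
    obtain ⟨a, rfl⟩ := hgen _ hcx y
    rw [smul_smul, smul_smul, ← Subring.mem_center_iff.1 hc a, mul_assoc, hci.eq, ← smul_smul]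

section Trace

variable {W : Type v} {P : W → ModuleCat.{u} A} {C C' : Set W}

theorem smul_eq_zero_of_mem_trace {M : Type*} [AddCommGroup M] [Module A M]
    (hM : ∀ r ∈ C, ∀ f : P r →ₗ[A] M, f = 0) {x : A} (hx : x ∈ trace P C (⊤ : Ideal A)) (m : M) :
    x • m = 0 := by
  have hker : trace P C ⊤ ≤ LinearMap.ker (LinearMap.toSpanSingleton A M m) :=
    trace_le_iff.2 fun r hr g _ => LinearMap.range_le_ker_iff.2 (hM r hr _)
  exact hker hx

theorem mul_eq_zero_of_mem_trace (hP : ∀ r ∈ C, Module.Projective A (P r))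
    (hCC' : ∀ r ∈ C, ∀ s ∈ C', ∀ f : P r →ₗ[A] P s, f = 0) {x y : A}
    (hx : x ∈ trace P C (⊤ : Ideal A)) (hy : y ∈ trace P C' (⊤ : Ideal A)) : x * y = 0 := by
  have hhom : ∀ r ∈ C, ∀ f : P r →ₗ[A] trace P C' (⊤ : Ideal A), f = 0 := fun r hr f => by
    have := hP r hr
    have hf : (trace P C' (⊤ : Ideal A)).subtype ∘ₗ f = 0 := by
      refine eq_zero_of_range_le_trace (N := (⊤ : Ideal A)) (hCC' r hr)
        ((LinearMap.range_comp_le_range _ _).trans ?_)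
      rw [Submodule.range_subtype]
    exact LinearMap.ext fun z => Subtype.ext (LinearMap.congr_fun hf z)
  exact congrArg Subtype.val (smul_eq_zero_of_mem_trace hhom hx ⟨y, hy⟩)

theorem IsProjectiveLabelling.exists_central_idempotent {L : W → ModuleCat.{u} A}
    (h : IsProjectiveLabelling L P)
    (hC : ∀ (r s : W) (f : P r →ₗ[A] P s), f ≠ 0 → (r ∈ C ↔ s ∈ C)) :
    ∃ c ∈ Subring.center A, IsIdempotentElem c ∧ (∀ r ∈ C, ∀ x : P r, c • x = x) ∧
      ∀ r ∉ C, ∀ x : P r, c • x = 0 := by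
  have hhom : ∀ r ∈ C, ∀ s ∈ Cᶜ, ∀ f : P r →ₗ[A] P s, f = 0 := fun r hr s hs f =>
    by_contra fun hf => hs ((hC r s f hf).1 hr)
  have hhom' : ∀ r ∈ Cᶜ, ∀ s ∈ C, ∀ f : P r →ₗ[A] P s, f = 0 := fun r hr s hs f =>
    by_contra fun hf => hr ((hC r s f hf).2 hs)
  obtain ⟨c, hcC, hc, hci, hdC⟩ :=
    exists_central_idempotent_of_sup_eq_top (h.trace_sup_trace_compl A C)
      (fun x hx y hy => mul_eq_zero_of_mem_trace (fun r _ => h.projective r) hhom hx hy)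
      (fun x hx y hy => mul_eq_zero_of_mem_trace (fun r _ => h.projective r) hhom' hx hy)
  refine ⟨c, hc, hci, fun r hr x => ?_, fun r hr => ?_⟩
  · have hd : (1 - c) • x = 0 := smul_eq_zero_of_mem_trace (fun s hs => hhom' s hs r hr) hdC x
    rw [sub_smul, one_smul, sub_eq_zero] at hd
    exact hd.symm
  · exact smul_eq_zero_of_mem_trace (fun s hs => hhom s hs r hr) hcC

end Trace

end CentralIdempotents

section Blocks

variable {A : Type u} [Ring A]

namespace Block

variable {b b' : Block A} {M N : Type*} [AddCommGroup M] [Module A M] [AddCommGroup N] [Module A N]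

theorem Contains.of_surjective (hM : b.Contains M) (f : M →ₗ[A] N) (hf : Function.Surjective f) :
    b.Contains N := by
  intro y
  obtain ⟨x, rfl⟩ := hf y
  rw [← map_smul, hM x]

theorem mul_eq_zero_or_eq (b : Block A) {c : A} (hc : c ∈ Subring.center A)
    (hci : IsIdempotentElem c) : c * b.1 = 0 ∨ c * b.1 = b.1 := by
  obtain ⟨hb, hbi, -, hprim⟩ := b.2
  exact hprim _ (mul_mem hc hb) (hci.mul_of_commute (Subring.mem_center_iff.1 hb c) hbi)
    (by rw [mul_assoc, hbi.eq])

theorem eq_of_hom (hM : b.Contains M) (hN : b'.Contains N) {f : M →ₗ[A] N} (hf : f ≠ 0) :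
    b = b' := by
  have hcomm : b.1 * b'.1 = b'.1 * b.1 := Subring.mem_center_iff.1 b'.2.1 b.1
  have hne : b'.1 * b.1 ≠ 0 := fun h0 => hf <| LinearMap.ext fun x => by
    rw [← hM x, map_smul, ← hN (f x), smul_smul, hcomm, h0, zero_smul, LinearMap.zero_apply]
  have hb := (b.mul_eq_zero_or_eq b'.2.1 b'.2.2.1).resolve_left hne
  have hb' := (b'.mul_eq_zero_or_eq b.2.1 b.2.2.1).resolve_left (hcomm ▸ hne)
  exact Subtype.ext (hb.symm.trans (hcomm.symm.trans hb'))

theorem exists_contains [IsArtinianRing A] [Nontrivial M]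
    (hM : ∀ c ∈ Subring.center A, IsIdempotentElem c →
      (∀ x : M, c • x = x) ∨ ∀ x : M, c • x = 0) : ∃ b : Block A, b.Contains M := by
  let T : Set A := {c | c ∈ Subring.center A ∧ IsIdempotentElem c ∧ ∀ x : M, c • x = x}
  obtain ⟨-, ⟨e, he, rfl⟩, hmin⟩ := exists_minimal_of_wellFoundedLT
    (fun I : Ideal A => ∃ c ∈ T, Ideal.span {c} = I)
    ⟨_, 1, ⟨one_mem _, .one, one_smul A⟩, rfl⟩
  obtain ⟨hec, hei, he1⟩ := id he
  have heq : ∀ f ∈ T, f * e = f → f = e := fun f hf hfe => by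
    have hle : Ideal.span {f} ≤ Ideal.span {e} :=
      (Ideal.span_singleton_le_iff_mem _).2 (Ideal.mem_span_singleton'.2 ⟨f, hfe⟩)
    obtain ⟨a, ha⟩ := Ideal.mem_span_singleton'.1
      (hmin ⟨f, hf, rfl⟩ hle (Ideal.mem_span_singleton_self e))
    rw [← hfe, Subring.mem_center_iff.1 hec f, ← ha, mul_assoc, hf.2.1.eq]
  refine ⟨⟨e, hec, hei, ?_, fun f hfc hfi hfe => ?_⟩, he1⟩
  · rintro rfl
    obtain ⟨x, hx⟩ := exists_ne (0 : M)
    exact hx (by rw [← he1 x, zero_smul])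
  · rcases hM f hfc hfi with hf1 | hf0
    · exact .inr (heq f ⟨hfc, hfi, hf1⟩ hfe)
    · have hef : e * f = f := by rw [← Subring.mem_center_iff.1 hec f, hfe]
      have hsub : e - f ∈ T := by
        refine ⟨sub_mem hec hfc, ?_, fun x => by rw [sub_smul, he1, hf0, sub_zero]⟩
        rw [IsIdempotentElem, mul_sub, sub_mul, sub_mul, hei.eq, hfe, hef, hfi.eq, sub_self,
          sub_zero]
      exact .inl (sub_eq_self.1 (heq _ hsub (by rw [sub_mul, hei.eq, hfe])))

end Block

namespace IsProjectiveLabelling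

variable {W : Type v} {L P : W → ModuleCat.{u} A}

theorem nontrivial_projective (h : IsProjectiveLabelling L P) (l : W) : Nontrivial (P l) :=
  have := h.simple l
  (h.cover l).nontrivial

theorem finite_projective (h : IsProjectiveLabelling L P) (l : W) : Module.Finite A (P l) :=
  have := h.simple l
  (h.cover l).finite

theorem exists_block [IsArtinianRing A] (h : IsProjectiveLabelling L P) (l : W) :
    ∃ b : Block A, b.Contains (P l) :=
  have := h.simple l
  have := h.nontrivial_projective l
  Block.exists_contains fun _ => (h.cover l).central_idempotent_smul

theorem exists_contains_projective (h : IsProjectiveLabelling L P) (b : Block A) :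
    ∃ l, b.Contains (P l) := by
  obtain ⟨hbc, hbi, hb0, -⟩ := b.2
  have : Nontrivial (Ideal.span {b.1}) :=
    Submodule.nontrivial_iff_ne_bot.2 (mt Ideal.span_singleton_eq_bot.1 hb0)
  have hspan : b.Contains (Ideal.span {b.1}) := by
    rintro ⟨x, hx⟩
    obtain ⟨a, rfl⟩ := Ideal.mem_span_singleton'.1 hx
    refine Subtype.ext ?_
    change b.1 * (a * b.1) = a * b.1
    rw [← Subring.mem_center_iff.1 hbc, mul_assoc, hbi.eq]
  obtain ⟨l, hl⟩ := h.exists_isCompFactor (Ideal.span {b.1})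
  obtain ⟨f, hf⟩ := h.isCompFactor_iff.1 hl
  have := h.simple l
  refine ⟨l, ((h.cover l).central_idempotent_smul hbc hbi).resolve_right fun h0 => hf ?_⟩
  exact LinearMap.ext fun x => by
    rw [← hspan (f x), ← map_smul, h0, map_zero, LinearMap.zero_apply]

theorem mem_of_block_contains (h : IsProjectiveLabelling L P) {C : Set W}
    (hC : ∀ (r s : W) (f : P r →ₗ[A] P s), f ≠ 0 → (r ∈ C ↔ s ∈ C)) {b : Block A} {l m : W}
    (hl : b.Contains (P l)) (hm : b.Contains (P m)) (hlC : l ∈ C) : m ∈ C := by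
  obtain ⟨c, hc, hci, hc1, hc0⟩ := h.exists_central_idempotent hC
  by_contra hmC
  rcases b.mul_eq_zero_or_eq hc hci with h0 | h1
  · obtain ⟨x, hx⟩ := @exists_ne _ (h.nontrivial_projective l) 0
    exact hx (by rw [← hc1 l hlC x, ← hl x, smul_smul, h0, zero_smul])
  · obtain ⟨x, hx⟩ := @exists_ne _ (h.nontrivial_projective m) 0
    exact hx (by rw [← hm x, ← h1, mul_smul, hc0 m hmC])

theorem block_eq_iff_standardLinked [PartialOrder W] [WellFoundedLT W] [IsNoetherianRing A]
    (h : IsProjectiveLabelling L P) (hA : IsQuasiHereditary L P) {D : Duality A}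
    (hD : D.SimplePreserving) {b : W → Block A} (hb : ∀ l, (b l).Contains (P l)) {l m : W} :
    b l = b m ↔ StandardLinked L P l m := by
  have hstd : ∀ l, (b l).Contains (standard L P l) := fun l =>
    (hb l).of_surjective _ (standardKernel L P l).mkQ_surjective
  constructor
  · intro hlm
    refine h.mem_of_block_contains (C := {r | StandardLinked L P l r}) (fun r s f hf => ?_)
      (hb l) (hlm ▸ hb m) (.refl l)
    have hrs := h.standardLinked_of_hom_projective hA hD hf
    exact ⟨fun hr => hr.trans _ _ _ hrs, fun hs => hs.trans _ _ _ (hrs.symm _ _)⟩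
  · intro hlm
    induction hlm with
    | rel l m hf => exact hf.elim fun f hf => Block.eq_of_hom (hstd l) (hstd m) hf
    | refl => rfl
    | symm _ _ _ ih => exact ih.symm
    | trans _ _ _ _ _ ih₁ ih₂ => exact ih₁.trans ih₂

end IsProjectiveLabelling

end Blocks

theorem exists_equiv_apply_eq {α β γ : Type*} {p : α → β} {q : α → γ}
    (hp : Function.Surjective p) (hq : Function.Surjective q)
    (hpq : ∀ a a', p a = p a' ↔ q a = q a') : ∃ e : β ≃ γ, ∀ a, e (p a) = q a := by
  have hcomp : ∀ a, q (Function.surjInv hp (p a)) = q a := fun a =>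
    (hpq _ _).1 (Function.surjInv_eq hp _)
  have hinj : Function.Injective (q ∘ Function.surjInv hp) := fun x y hxy => by
    rw [← Function.surjInv_eq hp x, ← Function.surjInv_eq hp y]
    exact (hpq _ _).2 hxy
  have hsurj : Function.Surjective (q ∘ Function.surjInv hp) := fun y =>
    (hq y).imp' p fun a ha => (hcomp a).trans ha
  exact ⟨Equiv.ofBijective _ ⟨hinj, hsurj⟩, hcomp⟩

end QuasiHered

theorem propositionA1 {k : Type w} [Field k] {A : Type u} [Ring A] [Algebra k A]
    [Module.Finite k A] {W : Type v} [Finite W] [PartialOrder W]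
    (L P : W → ModuleCat.{u} A)
    (hL : QuasiHered.IsSimpleLabelling L)
    (hP : ∀ l, QuasiHered.IsProjectiveCover A (P l) (L l))
    (hA : QuasiHered.IsQuasiHereditary L P)
    (D : QuasiHered.Duality A) (hD : D.SimplePreserving) :
    ∃ Φ : Quiver.WeaklyConnectedComponent (QuasiHered.HomQuiver k L P) ≃ QuasiHered.Block A,
      ∀ l : W,
        (Φ (QuasiHered.homComponent k L P l)).Contains (L l) ∧
        (Φ (QuasiHered.homComponent k L P l)).Contains (QuasiHered.standard L P l) ∧
        (Φ (QuasiHered.homComponent k L P l)).Contains (P l) := by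
  have h : QuasiHered.IsProjectiveLabelling L P := ⟨hL, hP⟩
  have : IsNoetherianRing A := isNoetherian_of_tower k inferInstance
  have : IsArtinianRing A := isArtinian_of_tower k inferInstance
  choose b hb using h.exists_block
  have hsurj : Function.Surjective b := fun b' => by
    obtain ⟨l, hl⟩ := h.exists_contains_projective b'
    have := h.nontrivial_projective l
    exact ⟨l, QuasiHered.Block.eq_of_hom (hb l) hl (one_ne_zero (α := Module.End A (P l)))⟩
  have hiff : ∀ l m,
      QuasiHered.homComponent k L P l = QuasiHered.homComponent k L P m ↔ b l = b m := fun l m =>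
    (QuasiHered.homComponent_eq_iff_standardLinked h.finite_projective).trans
      (h.block_eq_iff_standardLinked hA hD hb).symm
  have hcomp : Function.Surjective (QuasiHered.homComponent k L P) := Quot.mk_surjective
  obtain ⟨Φ, hΦ⟩ := QuasiHered.exists_equiv_apply_eq hcomp hsurj hiff
  refine ⟨Φ, fun l => ?_⟩
  rw [hΦ]
  obtain ⟨-, π, hπ, -⟩ := hP l
  exact ⟨(hb l).of_surjective π hπ, (hb l).of_surjective _ (Submodule.mkQ_surjective _), hb l⟩
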